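/- There is an absolute constant $K>0$ such that the following holds. Let $x$ be a random vector in $\mathbb{R}^d$, $d\ge 2$, with mean zero, finite second moments and positive-definite covariance matrix $\Sigma$, and let $\lambda_{\max}$ be the largest eigenvalue of $\Sigma$. Write $\langle u,v\rangle_\Sigma = u^\top\Sigma v$, $\|u\|_\Sigma=\sqrt{\langle u,u\rangle_\Sigma}$ and $\cos_\Sigma(u,v)=\langle u,v\rangle_\Sigma/(\|u\|_\Sigma\|v\|_\Sigma)$. Suppose that $x$ has a density $f$ with respect to Lebesgue measure whose Fourier transform $\hat f(\xi)=\int_{\mathbb{R}^d} f(y)\,e^{-2\pi i\langle y,\xi\rangle}\,dy$ satisfies $$|\hat f(\xi)|\le C(1+\|\xi\|)^{-k}\qquad\text{for all }\xi\in\mathbb{R}^d,$$ for some constant $C\ge 1$ and integer $k\ge 3$. Let $\varphi,\psi\in\mathbb{R}^d$ be linearly independent, let $\varepsilon\ge 0$, and suppose that $x$ is $\varepsilon$-elliptical along $E=\operatorname{span}\{\varphi,\psi\}$, that is, for all $v\in E\setminus\{0\}$ and all $u\in\mathbb{R}^d$ with $u^\top\Sigma v=0$, $$\bigl|\mathbb{E}[\,u^\top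 x\mid v^\top x\,]\bigr|\le \varepsilon\,\|u\|_\Sigma\quad\text{almost surely.}$$ Then $$\Bigl|\Pr[\operatorname{sgn}\varphi^\top x\neq\operatorname{sgn}\psi^\top x]-\frac1\pi\arccos\bigl(\cos_\Sigma(\varphi,\psi)\bigr)\Bigr|\le K\,C^{\frac{3}{k+1}}\max\{1,\lambda_{\max}^{3/2}\}\,\varepsilon^{\frac12-\frac{3}{2(k+1)}}.$$ -/

import Mathlib

open MeasureTheory ProbabilityTheory
open scoped FourierTransform Matrix

noncomputable section

/-- The bilinear form `⟨x, y⟩_M = xᵀ M y` on `ℝ^d`. -/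
def matInner {d : ℕ} (M : Matrix (Fin d) (Fin d) ℝ) (x y : EuclideanSpace ℝ (Fin d)) : ℝ :=
  x.ofLp ⬝ᵥ (M *ᵥ y.ofLp)

/-- The norm `‖x‖_M = √⟨x, x⟩_M`. -/
def matNorm {d : ℕ} (M : Matrix (Fin d) (Fin d) ℝ) (x : EuclideanSpace ℝ (Fin d)) : ℝ :=
  Real.sqrt (matInner M x x)

/-- The cosine similarity `cos_M(x, y) = ⟨x, y⟩_M / (‖x‖_M ‖y‖_M)`. -/
def matCos {d : ℕ} (M : Matrix (Fin d) (Fin d) ℝ) (x y : EuclideanSpace ℝ (Fin d)) : ℝ :=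
  matInner M x y / (matNorm M x * matNorm M y)

/-- The top eigenvalue. For a real symmetric matrix of positive size the spectrum is the finite
non-empty set of its eigenvalues, so this supremum is its largest element. -/
def topEigenvalue {d : ℕ} (M : Matrix (Fin d) (Fin d) ℝ) : ℝ :=
  sSup (spectrum ℝ M)

/-- The covariance matrix of a random vector in `ℝ^d`, with entries `Cov(X_i, X_j)`. -/
def covMatrix {Ω : Type*} [MeasurableSpace Ω] {d : ℕ} (P : Measure Ω)
    (X : Ω → EuclideanSpace ℝ (Fin d)) : Matrix (Fin d) (Fin d) ℝ :=
  Matrix.of fun i j => covariance (fun ω => X ω i) (fun ω => X ω j) P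

/-- The random vector `X` is `ε`-elliptical along the nontrivial subspace `E`: it is
square-integrable with mean zero and positive-definite covariance `Σ`, and
`|𝔼[uᵀX | vᵀX]| ≤ ε ‖u‖_Σ` almost surely, for all `v ∈ E \ {0}` and all `u ∈ ℝ^d` with
`uᵀ Σ v = 0`. -/
structure IsEllipticalAlong {Ω : Type*} [MeasurableSpace Ω] {d : ℕ} (P : Measure Ω)
    (X : Ω → EuclideanSpace ℝ (Fin d)) (ε : ℝ) (E : Submodule ℝ (EuclideanSpace ℝ (Fin d))) :
    Prop where
  memLp_two : MemLp X 2 P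
  mean_zero : ∫ ω, X ω ∂P = 0
  posDef : (covMatrix P X).PosDef
  ne_bot : E ≠ ⊥
  abs_condExp_le : ∀ v ∈ E, v ≠ 0 → ∀ u : EuclideanSpace ℝ (Fin d),
    matInner (covMatrix P X) u v = 0 →
      ∀ᵐ ω ∂P, |(P[fun ω' => inner ℝ u (X ω') |
          MeasurableSpace.comap (fun ω' => inner ℝ v (X ω')) (borel ℝ)]) ω|
        ≤ ε * matNorm (covMatrix P X) u

end

/-! In a `Σ`-orthonormal basis of `E` the problem concerns a planar law `μ` with second moment `2`,
and the disagreement event is a double wedge bounded by two lines at angle `θ = arccos (cos_Σ(φ,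
ψ))`. For any law without mass at the origin, the average of the wedge's mass over all rotations is
exactly `θ / π` (`integral_measureReal_doubleWedge`), so it suffices that `μ` be almost rotation
invariant.

The angular derivative of the characteristic function at `w` is, up to a factor `i`, the integral of
`⟨iw, z⟩ exp(i⟨w, z⟩)`. Since `iw` is orthogonal to `w`, ellipticity bounds it by `2ε‖w‖`, and a
rotation moves the characteristic function at `ξ` by `O(ε‖ξ‖)` (`norm_charFun_rotation_sub_le`).
Fourier decay takes over at frequencies above a scale `S`, so the characteristic functions of `μ`
and its rotation are within `δ = O(ε S³)` in `L¹`. Hence each law is at most the other plus `δ`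
times Lebesgue measure (`measure_le_add_smul_volume_of_integral_charFun_sub_le`), and Chebyshev
truncation turns this into an `O(√δ)` bound for every set (`measureReal_le_add_sqrt`). Balancing the
two frequency regimes fixes `S` and gives the exponents (`exists_scale_sqrt_le`). -/

/-! ### Comparing measures through their characteristic functions -/

section FourierComparison

open scoped ContDiff

variable {V : Type*} [NormedAddCommGroup V] [InnerProductSpace ℝ V] [FiniteDimensional ℝ V]
  [MeasurableSpace V] [BorelSpace V]

/-- Fourier inversion under a finite measure: the integral of a Schwartz function is the integral
of its Fourier transform against the characteristic function. -/
theorem integral_schwartz_eq_integral_fourier_mul_charFun (μ : Measure V) [IsFiniteMeasure μ]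
    (f : SchwartzMap V ℂ) :
    ∫ x, f x ∂μ = ∫ ξ, 𝓕 f ξ * charFun μ ((2 * Real.pi) • ξ) := by
  have h1 : ∀ x, f x = ∫ ξ, Complex.exp (((2 * Real.pi * inner ℝ ξ x : ℝ) : ℂ) * Complex.I)
      * 𝓕 f ξ := by
    intro x
    conv_lhs => rw [← FourierTransform.fourierInv_fourier_eq (F := SchwartzMap V ℂ) f]
    rw [SchwartzMap.fourierInv_coe, Real.fourierInv_eq']
    simp [smul_eq_mul]
  calc ∫ x, f x ∂μ = ∫ x, (∫ ξ, Complex.exp (((2 * Real.pi * inner ℝ ξ x : ℝ) : ℂ) * Complex.I)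
      * 𝓕 f ξ) ∂μ := by congr 1; ext x; exact h1 x
    _ = ∫ ξ, (∫ x, Complex.exp (((2 * Real.pi * inner ℝ ξ x : ℝ) : ℂ) * Complex.I)
      * 𝓕 f ξ ∂μ) := by
        apply integral_integral_swap
        have hint : Integrable (fun p : V × V => 𝓕 f p.2) (μ.prod volume) :=
          (𝓕 f).integrable.comp_snd μ
        refine hint.mono ?_ ?_
        · refine AEStronglyMeasurable.mul ?_ hint.aestronglyMeasurable
          apply Continuous.aestronglyMeasurable
          fun_prop
        · refine Filter.Eventually.of_forall fun p => ?_
          simp only [Function.uncurry, norm_mul, Complex.norm_exp_ofReal_mul_I, one_mul, le_refl]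
    _ = ∫ ξ, 𝓕 f ξ * charFun μ ((2 * Real.pi) • ξ) := by
        congr 1; ext ξ
        rw [integral_mul_const, mul_comm, charFun_apply]
        congr 2; ext x
        rw [inner_smul_right, real_inner_comm]

theorem norm_fourier_schwartz_le (f : SchwartzMap V ℂ) (ξ : V) : ‖𝓕 f ξ‖ ≤ ∫ x, ‖f x‖ := by
  rw [SchwartzMap.fourier_coe]
  exact VectorFourier.norm_fourierIntegral_le_integral_norm _ _ _ _ _

/-- If the characteristic functions of two finite measures are close in `L¹`, the measures differ
by at most a multiple of Lebesgue measure. -/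
theorem measure_le_add_smul_volume_of_integral_charFun_sub_le (μ ν : Measure V)
    [IsFiniteMeasure μ] [IsFiniteMeasure ν] {δ : ℝ}
    (hint : Integrable fun ξ : V =>
      charFun μ ((2 * Real.pi) • ξ) - charFun ν ((2 * Real.pi) • ξ))
    (hδ : ∫ ξ : V, ‖charFun μ ((2 * Real.pi) • ξ) - charFun ν ((2 * Real.pi) • ξ)‖ ≤ δ) :
    μ ≤ ν + ENNReal.ofReal δ • volume := by
  have hδ0 : 0 ≤ δ := (integral_nonneg fun _ => norm_nonneg _).trans hδ
  -- Parseval, with the sup norm of the Fourier transform of `f` bounded by the `L¹` norm of `f`.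
  have htest : ∀ f : SchwartzMap V ℂ,
      ‖∫ x, f x ∂μ - ∫ x, f x ∂ν‖ ≤ δ * ∫ x, ‖f x‖ := by
    intro f
    have hchar : ∀ (ρ : Measure V) [IsFiniteMeasure ρ],
        Integrable fun ξ : V => 𝓕 f ξ * charFun ρ ((2 * Real.pi) • ξ) := by
      intro ρ _
      refine ((𝓕 f).integrable (μ := volume)).mul_bdd (c := ρ.real Set.univ) ?_ ?_
      · have := measurable_charFun (μ := ρ)
        exact (this.comp (measurable_const_smul _)).aestronglyMeasurable
      · exact Filter.Eventually.of_forall fun ξ => norm_charFun_le _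
    rw [integral_schwartz_eq_integral_fourier_mul_charFun,
      integral_schwartz_eq_integral_fourier_mul_charFun, ← integral_sub (hchar μ) (hchar ν)]
    calc _ ≤ ∫ ξ, ‖𝓕 f ξ * charFun μ ((2 * Real.pi) • ξ)
            - 𝓕 f ξ * charFun ν ((2 * Real.pi) • ξ)‖ := norm_integral_le_integral_norm _
      _ ≤ ∫ ξ, (∫ x, ‖f x‖) * ‖charFun μ ((2 * Real.pi) • ξ) - charFun ν ((2 * Real.pi) • ξ)‖ := by
          refine integral_mono ((hchar μ).sub (hchar ν)).norm (hint.norm.const_mul _) fun ξ => ?_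
          simp only [← mul_sub, norm_mul]
          gcongr
          exact norm_fourier_schwartz_le f ξ
      _ = (∫ x, ‖f x‖) * _ := integral_const_mul _ _
      _ ≤ (∫ x, ‖f x‖) * δ := by gcongr
      _ = _ := mul_comm _ _
  -- Test against a smooth bump equal to `1` on `K` and supported in `U`; boundedness of `U` makes
  -- the bump compactly supported and the volume of `U` finite.
  have hcompact : ∀ K U : Set V, IsCompact K → IsOpen U → Bornology.IsBounded U → K ⊆ U →
      μ K ≤ (ν + ENNReal.ofReal δ • volume : Measure V) U := by
    intro K U hK hU hUb hKU
    obtain ⟨g, hg, hg01, hgs, hg1⟩ := exists_contMDiff_support_eq_eq_one_iff (n := ⊤)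
      (modelWithCornersSelf ℝ V) hU hK.isClosed hKU
    have hg' : ContDiff ℝ ∞ (Complex.ofRealCLM ∘ g) :=
      Complex.ofRealCLM.contDiff.comp hg.contDiff
    have hgc : HasCompactSupport g := by
      refine HasCompactSupport.of_support_subset_isCompact hUb.isCompact_closure ?_
      rw [hgs]; exact subset_closure
    have hgc' : HasCompactSupport (Complex.ofRealCLM ∘ g) := hgc.comp_left rfl
    have hgcont : Continuous g := hg.continuous
    have h01 : ∀ x, 0 ≤ g x ∧ g x ≤ 1 := fun x => hg01 ⟨x, rfl⟩
    have hle : ∀ x, g x ≤ U.indicator 1 x := by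
      intro x
      by_cases hx : x ∈ U
      · simpa [hx] using (h01 x).2
      · have : x ∉ Function.support g := by rwa [hgs]
        simp [hx, Function.notMem_support.mp this]
    have key := htest (hgc'.toSchwartzMap hg')
    have e1 : ∀ ρ : Measure V, ∫ x, (hgc'.toSchwartzMap hg') x ∂ρ = ((∫ x, g x ∂ρ : ℝ) : ℂ) := by
      exact fun ρ => integral_ofReal (𝕜 := ℂ) (f := g)
    have e2 : ∫ x, ‖(hgc'.toSchwartzMap hg') x‖ = ∫ x, g x := by
      congr 1; ext x
      change ‖((g x : ℝ) : ℂ)‖ = g x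
      rw [Complex.norm_real, Real.norm_of_nonneg (h01 x).1]
    rw [e1, e1, e2, ← Complex.ofReal_sub, Complex.norm_real, Real.norm_eq_abs] at key
    have key' := (le_abs_self _).trans key
    have hi : ∀ ρ : Measure V, [IsFiniteMeasureOnCompacts ρ] → Integrable g ρ := fun ρ _ =>
      hgcont.integrable_of_hasCompactSupport hgc
    have hub : ∀ ρ : Measure V, [IsFiniteMeasureOnCompacts ρ] → ∫ x, g x ∂ρ ≤ ρ.real U := by
      intro ρ _
      rw [← integral_indicator_one hU.measurableSet]
      refine integral_mono (hi ρ) ?_ hle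
      exact (integrable_indicator_iff hU.measurableSet).2
        (integrableOn_const hUb.measure_lt_top.ne)
    have hlb : μ.real K ≤ ∫ x, g x ∂μ := by
      rw [← integral_indicator_one hK.measurableSet]
      refine integral_mono ?_ (hi μ) fun x => ?_
      · exact (integrable_indicator_iff hK.measurableSet).2 (integrableOn_const (measure_ne_top _ _))
      · by_cases hx : x ∈ K
        · simp [hx, (hg1 x).1 hx]
        · simpa [hx] using (h01 x).1
    have hfin : μ.real K ≤ ν.real U + δ * (volume : Measure V).real U := by
      have := hub ν
      have := mul_le_mul_of_nonneg_left (hub (volume : Measure V)) hδ0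
      linarith
    rw [← ENNReal.ofReal_toReal (measure_ne_top μ K)]
    refine (ENNReal.ofReal_le_ofReal hfin).trans ?_
    rw [ENNReal.ofReal_add measureReal_nonneg (mul_nonneg hδ0 measureReal_nonneg),
      ENNReal.ofReal_mul hδ0, Measure.add_apply, Measure.smul_apply, smul_eq_mul]
    simp only [Measure.real]
    rw [ENNReal.ofReal_toReal (measure_ne_top ν U), ENNReal.ofReal_toReal hUb.measure_lt_top.ne]
  -- Needed for outer regularity of the right-hand side, which shrinks `U` to `K`; inner regularity
  -- of `μ` then passes from compact to measurable sets.
  have : IsLocallyFiniteMeasure (ν + ENNReal.ofReal δ • (volume : Measure V)) :=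
    @isLocallyFiniteMeasure_of_isFiniteMeasureOnCompacts _ _ _ _ _ ⟨fun K hK => by
      rw [Measure.add_apply, Measure.smul_apply, smul_eq_mul]
      exact ENNReal.add_lt_top.2 ⟨measure_lt_top _ _,
        ENNReal.mul_lt_top ENNReal.ofReal_lt_top hK.measure_lt_top⟩⟩
  have hK : ∀ K : Set V, IsCompact K → μ K ≤ (ν + ENNReal.ofReal δ • volume : Measure V) K := by
    intro K hK
    rw [K.measure_eq_iInf_isOpen (ν + ENNReal.ofReal δ • volume)]
    refine le_iInf₂ fun U hKU => le_iInf fun hU => ?_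
    obtain ⟨r, hr⟩ := hK.isBounded.subset_ball 0
    exact (hcompact K (U ∩ Metric.ball 0 r) hK (hU.inter Metric.isOpen_ball)
      (Metric.isBounded_ball.subset Set.inter_subset_right)
      (Set.subset_inter hKU hr)).trans (measure_mono Set.inter_subset_left)
  refine Measure.le_iff.2 fun A hA => ?_
  rw [hA.measure_eq_iSup_isCompact_of_ne_top (measure_ne_top μ A)]
  exact iSup₂_le fun K hKA => iSup_le fun hKc => (hK K hKc).trans (measure_mono hKA)

end FourierComparison

/-! ### The bilinear form of a matrix and its top eigenvalue -/

section MatInner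

variable {d : ℕ} (M : Matrix (Fin d) (Fin d) ℝ)

theorem matInner_add_left (x y z : EuclideanSpace ℝ (Fin d)) :
    matInner M (x + y) z = matInner M x z + matInner M y z := by
  simp [matInner, add_dotProduct]

theorem matInner_smul_left (c : ℝ) (x y : EuclideanSpace ℝ (Fin d)) :
    matInner M (c • x) y = c * matInner M x y := by
  simp [matInner]

theorem matInner_add_right (x y z : EuclideanSpace ℝ (Fin d)) :
    matInner M x (y + z) = matInner M x y + matInner M x z := by
  simp [matInner, Matrix.mulVec_add]

theorem matInner_smul_right (c : ℝ) (x y : EuclideanSpace ℝ (Fin d)) :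
    matInner M x (c • y) = c * matInner M x y := by
  simp [matInner, Matrix.mulVec_smul]

variable {M}

theorem matInner_comm (hM : M.IsHermitian) (x y : EuclideanSpace ℝ (Fin d)) :
    matInner M x y = matInner M y x := by
  have hT : Mᵀ = M := by simpa [Matrix.IsHermitian] using hM
  rw [matInner, matInner, Matrix.dotProduct_mulVec, ← Matrix.mulVec_transpose, hT,
    dotProduct_comm]

theorem matInner_self_pos (hM : M.PosDef) {x : EuclideanSpace ℝ (Fin d)} (hx : x ≠ 0) :
    0 < matInner M x x := by
  have := hM.dotProduct_mulVec_pos (x := x.ofLp) (by simpa using hx)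
  simpa [matInner] using this

/-- The spectrum of `topEigenvalue M • 1 - M` is `topEigenvalue M` minus that of `M`, hence
nonnegative, so this Hermitian matrix is positive semidefinite. -/
theorem matInner_self_le_topEigenvalue_mul (hM : M.IsHermitian) (x : EuclideanSpace ℝ (Fin d)) :
    matInner M x x ≤ topEigenvalue M * ‖x‖ ^ 2 := by
  have hN : (algebraMap ℝ (Matrix (Fin d) (Fin d) ℝ) (topEigenvalue M) - M).IsHermitian := by
    refine Matrix.IsHermitian.sub ?_ hM
    rw [Matrix.IsHermitian, Matrix.algebraMap_eq_diagonal, Matrix.diagonal_conjTranspose]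
    rfl
  have hpos : (algebraMap ℝ (Matrix (Fin d) (Fin d) ℝ) (topEigenvalue M) - M).PosSemidef := by
    rw [hN.posSemidef_iff_eigenvalues_nonneg]
    intro i
    have hi : hN.eigenvalues i ∈ spectrum ℝ
        (algebraMap ℝ (Matrix (Fin d) (Fin d) ℝ) (topEigenvalue M) - M) := by
      rw [hN.spectrum_real_eq_range_eigenvalues]; exact ⟨i, rfl⟩
    rw [← spectrum.singleton_sub_eq] at hi
    obtain ⟨a, ha, b, hb, hab⟩ := Set.mem_sub.1 hi
    rw [Set.mem_singleton_iff.1 ha] at hab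
    have hbdd : BddAbove (spectrum ℝ M) := by
      rw [hM.spectrum_real_eq_range_eigenvalues]
      exact (Set.finite_range _).bddAbove
    have : b ≤ topEigenvalue M := le_csSup hbdd hb
    simp only [Pi.zero_apply]
    linarith
  have := hpos.dotProduct_mulVec_nonneg x.ofLp
  rw [Matrix.sub_mulVec, dotProduct_sub, sub_nonneg] at this
  have h2 : (star x.ofLp) ⬝ᵥ ((algebraMap ℝ (Matrix (Fin d) (Fin d) ℝ) (topEigenvalue M)) *ᵥ x.ofLp)
      = topEigenvalue M * ‖x‖ ^ 2 := by
    rw [Algebra.algebraMap_eq_smul_one, Matrix.smul_mulVec, Matrix.one_mulVec, dotProduct_smul,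
      smul_eq_mul, EuclideanSpace.real_norm_sq_eq]
    simp [dotProduct, sq]
  rw [h2] at this
  simpa [matInner] using this

theorem topEigenvalue_pos (hd : 0 < d) (hM : M.PosDef) : 0 < topEigenvalue M := by
  set x : EuclideanSpace ℝ (Fin d) := EuclideanSpace.single ⟨0, hd⟩ 1
  have hx : ‖x‖ = 1 := by simp [x]
  have h1 := matInner_self_pos hM (x := x) (by rw [← norm_ne_zero_iff, hx]; norm_num)
  have h2 := matInner_self_le_topEigenvalue_mul hM.isHermitian x
  rw [hx] at h2
  linarith

end MatInner

/-! ### Second moments of linear marginals -/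

section SecondMoment

variable {Ω : Type*} [MeasurableSpace Ω] {d : ℕ} {P : Measure Ω}
  {X : Ω → EuclideanSpace ℝ (Fin d)}

theorem memLp_two_inner (hX : MemLp X 2 P) (u : EuclideanSpace ℝ (Fin d)) :
    MemLp (fun ω => inner ℝ u (X ω)) 2 P :=
  hX.const_inner u

theorem matInner_covMatrix_self [IsProbabilityMeasure P] (hX : MemLp X 2 P) (h0 : ∫ ω, X ω ∂P = 0)
    (u : EuclideanSpace ℝ (Fin d)) :
    matInner (covMatrix P X) u u = ∫ ω, (inner ℝ u (X ω)) ^ 2 ∂P := by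
  have hc : ∀ i, MemLp (fun ω => X ω i) 2 P := fun i => by
    have := memLp_two_inner hX (EuclideanSpace.single i (1 : ℝ))
    simpa [EuclideanSpace.inner_single_left] using this
  have hm : ∀ i, ∫ ω, X ω i ∂P = 0 := fun i => by
    have := integral_inner (𝕜 := ℝ) (hX.integrable (by norm_num))
      (EuclideanSpace.single i (1 : ℝ))
    rw [h0] at this
    simpa [EuclideanSpace.inner_single_left] using this
  have hij : ∀ i j, Integrable (fun ω => X ω i * X ω j) P := fun i j => (hc i).integrable_mul (hc j)
  have hcov : ∀ i j, covMatrix P X i j = ∫ ω, X ω i * X ω j ∂P := fun i j => by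
    simp only [covMatrix, Matrix.of_apply, covariance, hm, sub_zero]
  have hsq : ∀ ω, (inner ℝ u (X ω)) ^ 2 = ∑ i, ∑ j, u i * u j * (X ω i * X ω j) := fun ω => by
    rw [sq, PiLp.inner_apply, Finset.sum_mul_sum]
    refine Finset.sum_congr rfl fun i _ => Finset.sum_congr rfl fun j _ => ?_
    simp only [RCLike.inner_apply, conj_trivial]
    ring
  simp_rw [hsq]
  rw [integral_finsetSum _ fun i _ => integrable_finsetSum _ fun j _ => (hij i j).const_mul _]
  simp only [matInner, dotProduct, Matrix.mulVec, Finset.mul_sum]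
  refine Finset.sum_congr rfl fun i _ => ?_
  rw [integral_finsetSum _ fun j _ => (hij i j).const_mul _]
  refine Finset.sum_congr rfl fun j _ => ?_
  rw [integral_const_mul, hcov]
  ring

end SecondMoment

/-! ### From conditional expectations to the angular derivative -/

/-- As `h` is `m`-measurable, it pulls out of the conditional expectation, so `f` may be replaced by
`P[f | m]` under the integral. -/
theorem abs_integral_mul_le_of_abs_condExp_le {Ω : Type*} {m m0 : MeasurableSpace Ω}
    {P : Measure Ω} [IsProbabilityMeasure P] (hm : m ≤ m0) {f h : Ω → ℝ} (hf : Integrable f P)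
    (hh : StronglyMeasurable[m] h) (hb : ∀ ω, |h ω| ≤ 1) {c : ℝ}
    (hc : ∀ᵐ ω ∂P, |(P[f | m]) ω| ≤ c) : |∫ ω, h ω * f ω ∂P| ≤ c := by
  have hhf : Integrable (h * f) P :=
    hf.bdd_mul (c := 1) (hh.mono hm).aestronglyMeasurable (Filter.Eventually.of_forall hb)
  have h1 : ∫ ω, h ω * f ω ∂P = ∫ ω, h ω * (P[f | m]) ω ∂P := by
    calc ∫ ω, h ω * f ω ∂P = ∫ ω, (P[h * f | m]) ω ∂P := (integral_condExp hm).symm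
      _ = _ := integral_congr_ae (condExp_mul_of_stronglyMeasurable_left hh hhf hf)
  rw [h1, ← Real.norm_eq_abs]
  have := norm_integral_le_of_norm_le_const (μ := P) (f := fun ω => h ω * (P[f | m]) ω) (C := c) ?_
  · simpa using this
  · filter_upwards [hc] with ω hω
    rw [norm_mul, Real.norm_eq_abs, Real.norm_eq_abs]
    calc |h ω| * |(P[f | m]) ω| ≤ 1 * c := by
          gcongr
          exact hb ω
      _ = c := one_mul c

/-- If `|𝔼[f | g]| ≤ c` almost surely then `|𝔼[f e^{ig}]| ≤ 2c`. -/
theorem norm_integral_mul_exp_le_of_abs_condExp_le {Ω : Type*} {m0 : MeasurableSpace Ω}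
    {P : Measure Ω} [IsProbabilityMeasure P] {f g : Ω → ℝ} (hf : Integrable f P)
    (hg : Measurable g) {c : ℝ}
    (hc : ∀ᵐ ω ∂P, |(P[f | MeasurableSpace.comap g (borel ℝ)]) ω| ≤ c) :
    ‖∫ ω, (f ω : ℂ) * Complex.exp ((g ω : ℂ) * Complex.I) ∂P‖ ≤ 2 * c := by
  have hm : MeasurableSpace.comap g (borel ℝ) ≤ m0 := by
    rw [← BorelSpace.measurable_eq (α := ℝ)]; exact hg.comap_le
  have hgm : Measurable[MeasurableSpace.comap g (borel ℝ)] g := by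
    rw [← BorelSpace.measurable_eq (α := ℝ)]; exact comap_measurable g
  have hcos := abs_integral_mul_le_of_abs_condExp_le hm hf
    (h := fun ω => Real.cos (g ω)) (Real.measurable_cos.comp hgm).stronglyMeasurable
    (fun ω => Real.abs_cos_le_one _) hc
  have hsin := abs_integral_mul_le_of_abs_condExp_le hm hf
    (h := fun ω => Real.sin (g ω)) (Real.measurable_sin.comp hgm).stronglyMeasurable
    (fun ω => Real.abs_sin_le_one _) hc
  have hic : Integrable (fun ω => Real.cos (g ω) * f ω) P :=
    hf.bdd_mul (c := 1) (Real.measurable_cos.comp hg).aestronglyMeasurable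
      (Filter.Eventually.of_forall fun ω => Real.abs_cos_le_one _)
  have his : Integrable (fun ω => Real.sin (g ω) * f ω) P :=
    hf.bdd_mul (c := 1) (Real.measurable_sin.comp hg).aestronglyMeasurable
      (Filter.Eventually.of_forall fun ω => Real.abs_sin_le_one _)
  have e : ∫ ω, (f ω : ℂ) * Complex.exp ((g ω : ℂ) * Complex.I) ∂P
      = ((∫ ω, Real.cos (g ω) * f ω ∂P : ℝ) : ℂ)
        + ((∫ ω, Real.sin (g ω) * f ω ∂P : ℝ) : ℂ) * Complex.I := by
    rw [← integral_complex_ofReal, ← integral_complex_ofReal, ← integral_mul_const,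
      ← integral_add hic.ofReal (his.ofReal.mul_const _)]
    congr 1; ext ω
    rw [Complex.exp_mul_I]
    push_cast
    ring
  rw [e]
  refine (norm_add_le _ _).trans ?_
  rw [norm_mul, Complex.norm_I, mul_one, Complex.norm_real, Complex.norm_real]
  simp only [Real.norm_eq_abs]
  linarith

/-- A bound on the angular derivative of the characteristic function of a planar measure gives a
Lipschitz bound under rotations. -/
theorem norm_charFun_rotation_sub_le (μ : Measure ℂ) [IsFiniteMeasure μ]
    (hμ : Integrable (fun z => z) μ) {c : ℝ}
    (hc : ∀ w : ℂ, ‖∫ z, ((inner ℝ (Complex.I * w) z : ℝ) : ℂ)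
      * Complex.exp (((inner ℝ w z : ℝ) : ℂ) * Complex.I) ∂μ‖ ≤ c * ‖w‖) (ξ : ℂ)
    {α : ℝ} (hα : 0 ≤ α) :
    ‖charFun μ (Complex.exp (α * Complex.I) * ξ) - charFun μ ξ‖ ≤ c * ‖ξ‖ * α := by
  set w : ℝ → ℂ := fun t => Complex.exp (t * Complex.I) * ξ with hw
  have hwn : ∀ t, ‖w t‖ = ‖ξ‖ := fun t => by simp [hw, Complex.norm_exp_ofReal_mul_I]
  have hwd : ∀ t, HasDerivAt w (Complex.I * w t) t := fun t => by
    have h1 : HasDerivAt (fun t : ℝ => (t : ℂ) * Complex.I) (1 * Complex.I) t :=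
      (Complex.ofRealCLM.hasDerivAt (x := t)).mul_const _
    refine (h1.cexp.mul_const ξ).congr_deriv ?_
    rw [show w t = Complex.exp (t * Complex.I) * ξ from rfl]; ring
  have hwc : Continuous w := by fun_prop
  set F' : ℝ → ℂ → ℂ := fun t z => ((inner ℝ (Complex.I * w t) z : ℝ) : ℂ)
      * Complex.exp (((inner ℝ (w t) z : ℝ) : ℂ) * Complex.I) * Complex.I
  -- Differentiation under the integral: the path stays on the circle of radius `‖ξ‖`, so `‖ξ‖ *
  -- ‖z‖` dominates the derivative.
  have hG : ∀ t, HasDerivAt (fun t => charFun μ (w t)) (∫ z, F' t z ∂μ) t := by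
    intro t
    simp only [charFun_apply]
    refine (hasDerivAt_integral_of_dominated_loc_of_deriv_le (F := fun t z =>
      Complex.exp (((inner ℝ z (w t) : ℝ) : ℂ) * Complex.I)) (F' := F')
      (bound := fun z => ‖ξ‖ * ‖z‖) Filter.univ_mem ?_ ?_ ?_ ?_ ?_ ?_).2
    · refine Filter.Eventually.of_forall fun t => Continuous.aestronglyMeasurable ?_
      fun_prop
    · refine (integrable_const (1 : ℝ)).mono (Continuous.aestronglyMeasurable (by fun_prop)) ?_
      exact Filter.Eventually.of_forall fun z => by
        rw [Complex.norm_exp_ofReal_mul_I, norm_one]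
    · exact Continuous.aestronglyMeasurable (by fun_prop)
    · refine Filter.Eventually.of_forall fun z t _ => ?_
      simp only [F', norm_mul, Complex.norm_exp_ofReal_mul_I, Complex.norm_I, mul_one,
        Complex.norm_real]
      refine (norm_inner_le_norm _ _).trans ?_
      rw [norm_mul, Complex.norm_I, one_mul, hwn]
    · exact hμ.norm.const_mul _
    · refine Filter.Eventually.of_forall fun z t _ => ?_
      have h1 : HasDerivAt (fun t => (inner ℝ z (w t) : ℝ)) (inner ℝ z (Complex.I * w t)) t := by
        have := (hasDerivAt_const t z).inner ℝ (hwd t)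
        simpa using this
      have h2 := (h1.ofReal_comp.mul_const Complex.I).cexp
      refine h2.congr_deriv ?_
      simp only [F', real_inner_comm z]
      ring
  have hbound : ∀ t, ‖∫ z, F' t z ∂μ‖ ≤ c * ‖ξ‖ := by
    intro t
    simp only [F']
    rw [integral_mul_const, norm_mul, Complex.norm_I, mul_one, ← hwn t]
    exact hc (w t)
  have := norm_image_sub_le_of_norm_deriv_le_segment' (a := 0) (b := α)
    (fun t _ => (hG t).hasDerivWithinAt) (fun t _ => hbound t) α ⟨hα, le_rfl⟩
  simpa [hw] using this

/-! ### Double wedges and their average over rotations -/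

theorem sign_eq_sign_iff (a b : ℝ) :
    SignType.sign a = SignType.sign b ↔ (0 < a ↔ 0 < b) ∧ (a < 0 ↔ b < 0) := by
  rcases lt_trichotomy a 0 with ha | ha | ha <;> rcases lt_trichotomy b 0 with hb | hb | hb <;>
    simp [ha, hb, ha.not_gt, hb.not_gt, sign_pos, sign_neg]

theorem measurableSet_sign_ne {α : Type*} [MeasurableSpace α] {f g : α → ℝ} (hf : Measurable f)
    (hg : Measurable g) : MeasurableSet {x | SignType.sign (f x) ≠ SignType.sign (g x)} := by
  have : {x | SignType.sign (f x) ≠ SignType.sign (g x)}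
      = {x | (0 < f x ↔ 0 < g x) ∧ (f x < 0 ↔ g x < 0)}ᶜ := by
    ext x; simp only [Set.mem_ofPred_eq, Set.mem_compl_iff, ← sign_eq_sign_iff, ne_eq]
  rw [this]
  refine MeasurableSet.compl (Measurable.setOf (Measurable.and ?_ ?_))
  · exact Measurable.iff (measurableSet_lt measurable_const hf).mem
      (measurableSet_lt measurable_const hg).mem
  · exact Measurable.iff (measurableSet_lt hf measurable_const).mem
      (measurableSet_lt hg measurable_const).mem

/-- The set of phases at which `cos` and its shift by `θ` have different signs. -/
def phaseSet (θ : ℝ) : Set ℝ := {α | SignType.sign (Real.cos α) ≠ SignType.sign (Real.cos (α + θ))}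

theorem measurableSet_phaseSet (θ : ℝ) : MeasurableSet (phaseSet θ) :=
  measurableSet_sign_ne (by fun_prop) (by fun_prop)

/-- A shift by `π` negates both cosines, so whether their signs differ is unchanged. -/
theorem periodic_indicator_phaseSet (θ : ℝ) :
    Function.Periodic ((phaseSet θ).indicator (1 : ℝ → ℝ)) Real.pi := by
  intro α
  have : α + Real.pi ∈ phaseSet θ ↔ α ∈ phaseSet θ := by
    simp only [phaseSet, Set.mem_ofPred_eq]
    rw [add_right_comm, Real.cos_add_pi, Real.cos_add_pi, Left.sign_neg, Left.sign_neg,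
      ne_eq, ne_eq, neg_inj]
  by_cases h : α ∈ phaseSet θ
  · simp [h, this.2 h]
  · simp [h, mt this.1 h]

theorem intervalIntegrable_indicator_phaseSet (θ a b : ℝ) :
    IntervalIntegrable ((phaseSet θ).indicator (1 : ℝ → ℝ)) volume a b := by
  rw [intervalIntegrable_iff, Set.uIoc]
  exact (integrable_const (1 : ℝ)).indicator (measurableSet_phaseSet θ)

/-- On the period `(-π/2, π/2)` the first cosine is positive, and the shifted one is negative
exactly on `(π/2 - θ, π/2)`, so a period contributes `θ`. The interval covers two periods, and
periodicity removes `β`. -/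
theorem integral_indicator_phaseSet {θ : ℝ} (h0 : 0 ≤ θ) (hπ : θ ≤ Real.pi) (β : ℝ) :
    ∫ α in (0 : ℝ)..2 * Real.pi, (phaseSet θ).indicator (1 : ℝ → ℝ) (α - β) = 2 * θ := by
  have hper := periodic_indicator_phaseSet θ
  have hii := intervalIntegrable_indicator_phaseSet θ
  have hhalf : ∫ α in (-(Real.pi / 2))..(Real.pi / 2), (phaseSet θ).indicator (1 : ℝ → ℝ) α
      = θ := by
    rw [← intervalIntegral.integral_add_adjacent_intervals (b := Real.pi / 2 - θ)
      (hii _ _) (hii _ _)]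
    have e1 : ∫ α in (-(Real.pi / 2))..(Real.pi / 2 - θ), (phaseSet θ).indicator (1 : ℝ → ℝ) α
        = ∫ α in (-(Real.pi / 2))..(Real.pi / 2 - θ), (0 : ℝ) := by
      refine intervalIntegral.integral_congr_Ioo_of_le (by linarith) fun α hα => ?_
      have hα1 : 0 < Real.cos α := Real.cos_pos_of_mem_Ioo ⟨hα.1, by linarith [hα.2]⟩
      have hα2 : 0 < Real.cos (α + θ) :=
        Real.cos_pos_of_mem_Ioo ⟨by linarith [hα.1], by linarith [hα.2]⟩
      simp [phaseSet, sign_pos hα1, sign_pos hα2]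
    have e2 : ∫ α in (Real.pi / 2 - θ)..(Real.pi / 2), (phaseSet θ).indicator (1 : ℝ → ℝ) α
        = ∫ α in (Real.pi / 2 - θ)..(Real.pi / 2), (1 : ℝ) := by
      refine intervalIntegral.integral_congr_Ioo_of_le (by linarith) fun α hα => ?_
      have hα1 : 0 < Real.cos α := Real.cos_pos_of_mem_Ioo ⟨by linarith [hα.1], hα.2⟩
      have hα2 : Real.cos (α + θ) < 0 :=
        Real.cos_neg_of_pi_div_two_lt_of_lt (by linarith [hα.1]) (by linarith [hα.2])
      simp [phaseSet, sign_pos hα1, sign_neg hα2]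
    rw [e1, e2]; simp
  rw [intervalIntegral.integral_comp_sub_right (fun α => (phaseSet θ).indicator (1 : ℝ → ℝ) α) β]
  have h2 := (hper.nat_mul 2).intervalIntegral_add_eq (0 - β) (-(Real.pi / 2))
  have h3 := hper.intervalIntegral_add_eq (Real.pi / 2) (-(Real.pi / 2))
  rw [show 2 * Real.pi - β = 0 - β + (2 : ℕ) * Real.pi by push_cast; ring, h2,
    ← intervalIntegral.integral_add_adjacent_intervals (b := Real.pi / 2) (hii _ _) (hii _ _),
    show -(Real.pi / 2) + (2 : ℕ) * Real.pi = Real.pi / 2 + Real.pi by push_cast; ring, h3,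
    show -(Real.pi / 2) + Real.pi = Real.pi / 2 by ring, hhalf]
  ring

/-- The planar double wedge between the half-planes with unit normals at angles `α`, `α + θ`. -/
def doubleWedge (θ α : ℝ) : Set ℂ :=
  {z | SignType.sign (inner ℝ (Complex.exp (α * Complex.I)) z : ℝ)
    ≠ SignType.sign (inner ℝ (Complex.exp ((α + θ : ℝ) * Complex.I)) z : ℝ)}

theorem measurableSet_doubleWedge_prod (θ : ℝ) :
    MeasurableSet {p : ℝ × ℂ | p.2 ∈ doubleWedge θ p.1} :=
  measurableSet_sign_ne (Continuous.measurable (by fun_prop)) (Continuous.measurable (by fun_prop))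

theorem measurableSet_doubleWedge (θ α : ℝ) : MeasurableSet (doubleWedge θ α) :=
  measurable_prodMk_left (measurableSet_doubleWedge_prod θ)

theorem inner_exp_eq_norm_mul_cos (α : ℝ) (z : ℂ) :
    inner ℝ (Complex.exp (α * Complex.I)) z = ‖z‖ * Real.cos (α - z.arg) := by
  rw [Complex.inner]
  conv_lhs => rw [← Complex.norm_mul_exp_arg_mul_I z]
  rw [← Complex.exp_conj, mul_assoc, ← Complex.exp_add, Complex.re_ofReal_mul, map_mul,
    Complex.conj_ofReal, Complex.conj_I, show (z.arg : ℂ) * Complex.I + (α : ℂ) * -Complex.I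
      = ((z.arg - α : ℝ) : ℂ) * Complex.I by push_cast; ring, Complex.exp_ofReal_mul_I_re,
    ← Real.cos_neg, neg_sub]

theorem mem_doubleWedge_iff {z : ℂ} (hz : z ≠ 0) (θ α : ℝ) :
    z ∈ doubleWedge θ α ↔ α - z.arg ∈ phaseSet θ := by
  have hz' : 0 < ‖z‖ := norm_pos_iff.2 hz
  rw [doubleWedge, phaseSet, Set.mem_ofPred_eq, Set.mem_ofPred_eq, inner_exp_eq_norm_mul_cos,
    inner_exp_eq_norm_mul_cos, sign_mul, sign_mul, sign_pos hz', one_mul, one_mul,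
    add_sub_right_comm]

/-- Fubini: for `z ≠ 0` the angles whose wedge contains `z` form a translate of `phaseSet θ` by
`z.arg`, of length `2 * θ` whatever `z` is. The origin lies in no wedge, so it must carry no mass.
-/
theorem integral_measureReal_doubleWedge (μ : Measure ℂ) [IsProbabilityMeasure μ]
    (h0μ : μ {0} = 0) {θ : ℝ} (h0 : 0 ≤ θ) (hπ : θ ≤ Real.pi) :
    ∫ α in (0 : ℝ)..2 * Real.pi, μ.real (doubleWedge θ α) = 2 * θ := by
  rw [intervalIntegral.integral_of_le (by positivity)]
  have hne : ∀ᵐ z ∂μ, z ≠ 0 := by rw [ae_iff]; simpa using h0μ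
  calc ∫ α in Set.Ioc (0 : ℝ) (2 * Real.pi), μ.real (doubleWedge θ α)
      = ∫ α in Set.Ioc (0 : ℝ) (2 * Real.pi), ∫ z, (doubleWedge θ α).indicator (1 : ℂ → ℝ) z ∂μ := by
        congr 1; ext α
        rw [integral_indicator_one (measurableSet_doubleWedge θ α)]
    _ = ∫ z, (∫ α in Set.Ioc (0 : ℝ) (2 * Real.pi),
          (doubleWedge θ α).indicator (1 : ℂ → ℝ) z) ∂μ := by
        refine integral_integral_swap ?_
        have : (Function.uncurry fun α z => (doubleWedge θ α).indicator (1 : ℂ → ℝ) z)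
            = {p : ℝ × ℂ | p.2 ∈ doubleWedge θ p.1}.indicator 1 := by
          rfl
        rw [this]
        exact (integrable_const (1 : ℝ)).indicator (measurableSet_doubleWedge_prod θ)
    _ = ∫ z, 2 * θ ∂μ := by
        refine integral_congr_ae ?_
        filter_upwards [hne] with z hz
        rw [← integral_indicator_phaseSet h0 hπ z.arg,
          intervalIntegral.integral_of_le (by positivity)]
        congr 1; ext α
        by_cases hα : z ∈ doubleWedge θ α
        · simp [hα, (mem_doubleWedge_iff hz θ α).1 hα]
        · simp [hα, mt (mem_doubleWedge_iff hz θ α).2 hα]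
    _ = 2 * θ := by simp

/-! ### Quantitative near-invariance under rotation -/

/-- `heq` makes `ε * s` and `C * (ρ / s) ^ k` agree at `s = S`. Below `S` the linear bound suffices;
above it, `k ≥ 3` gives `(S / s) ^ k ≤ (S / s) ^ 3`. The exponent `-3` is chosen to be integrable in
the plane, and `2 ≤ c` absorbs the factor `2` in `h2`. -/
theorem le_rpow_neg_three_of_le_of_le {c ε S C ρ s D : ℝ} {k : ℕ} (hc : 2 ≤ c) (hε : 0 ≤ ε)
    (hS : 0 < S) (hC : 0 ≤ C) (hρ : 0 < ρ) (hs : 0 ≤ s) (hk : 3 ≤ k)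
    (heq : ε * S ^ (k + 1) = C * ρ ^ k)
    (h1 : D ≤ c * ε * s) (h2 : D ≤ 2 * (C * (1 + s / ρ) ^ (-(k : ℤ)))) :
    D ≤ 8 * c * ε * S * (1 + s / S) ^ (-3 : ℝ) := by
  have hrw : (1 + s / S) ^ (-3 : ℝ) = ((1 + s / S) ^ 3)⁻¹ := by
    rw [Real.rpow_neg (by positivity), ← Real.rpow_natCast]; norm_num
  rw [hrw]
  rcases le_or_gt s S with hsS | hsS
  · have ht : s / S ≤ 1 := (div_le_one hS).2 hsS
    have h8 : (1 + s / S) ^ 3 ≤ 8 := by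
      calc (1 + s / S) ^ 3 ≤ 2 ^ 3 := by gcongr; linarith
        _ = 8 := by norm_num
    calc D ≤ c * ε * s := h1
      _ ≤ c * ε * S := by gcongr
      _ = 8 * c * ε * S * 8⁻¹ := by ring
      _ ≤ _ := by gcongr
  · have hs0 : 0 < s := hS.trans hsS
    have h3 : (1 + s / ρ) ^ (-(k : ℤ)) ≤ ρ ^ k / s ^ k := by
      rw [zpow_neg, zpow_natCast, ← inv_pow, ← div_pow, ← inv_div s ρ]
      gcongr
      linarith
    have h4 : S ^ k / s ^ k ≤ 8 * ((1 + s / S) ^ 3)⁻¹ := by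
      rw [← div_pow]
      calc (S / s) ^ k ≤ (S / s) ^ 3 :=
            pow_le_pow_of_le_one (by positivity) ((div_le_one hs0).2 hsS.le) hk
        _ = 8 * ((2 * (s / S)) ^ 3)⁻¹ := by field_simp; norm_num
        _ ≤ _ := by
            have : 1 ≤ s / S := (one_le_div hS).2 hsS.le
            gcongr
            linarith
    calc D ≤ 2 * (C * (1 + s / ρ) ^ (-(k : ℤ))) := h2
      _ ≤ 2 * (C * (ρ ^ k / s ^ k)) := by gcongr
      _ = 2 * ε * S * (S ^ k / s ^ k) := by
          rw [← mul_div_assoc, ← heq, pow_succ]; ring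
      _ ≤ 2 * ε * S * (8 * ((1 + s / S) ^ 3)⁻¹) := by gcongr
      _ ≤ c * ε * S * (8 * ((1 + s / S) ^ 3)⁻¹) := by gcongr
      _ = _ := by ring

theorem integrable_one_add_norm_div_rpow {S : ℝ} (hS : 0 < S) :
    Integrable fun ξ : ℂ => (1 + ‖ξ‖ / S) ^ (-3 : ℝ) := by
  have h : Integrable fun ξ : ℂ => (1 + ‖ξ‖) ^ (-3 : ℝ) :=
    integrable_one_add_norm (by rw [Complex.finrank_real_complex]; norm_num)
  have := h.comp_smul (inv_ne_zero hS.ne')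
  simpa [norm_smul, abs_of_pos hS, div_eq_inv_mul] using this

theorem integral_one_add_norm_div_rpow {S : ℝ} (hS : 0 < S) :
    ∫ ξ : ℂ, (1 + ‖ξ‖ / S) ^ (-3 : ℝ) = S ^ 2 * ∫ ξ : ℂ, (1 + ‖ξ‖) ^ (-3 : ℝ) := by
  have := Measure.integral_comp_smul (volume : Measure ℂ)
    (fun ξ : ℂ => (1 + ‖ξ‖) ^ (-3 : ℝ)) S⁻¹
  simpa [norm_smul, abs_of_pos hS, div_eq_inv_mul, Complex.finrank_real_complex] using this

/-- Truncate to the disc of area `π * r`: the Lebesgue term costs `δ * π * r` and Markov bounds the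
tail by `2 / r`. The choice `r = 1 / √δ` makes both of order `√δ`. -/
theorem measureReal_le_add_sqrt {μ ν : Measure ℂ} [IsProbabilityMeasure μ]
    [IsFiniteMeasure ν] {δ : ℝ} (hδ : 0 < δ) (h : μ ≤ ν + ENNReal.ofReal δ • volume)
    (hint : Integrable (fun z => ‖z‖ ^ 2) μ) (h2 : ∫ z, ‖z‖ ^ 2 ∂μ ≤ 2) (A : Set ℂ) :
    μ.real A ≤ ν.real A + (Real.pi + 2) * √δ := by
  set r : ℝ := 1 / √δ with hr
  have hsδ : 0 < √δ := Real.sqrt_pos.2 hδ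
  have hr0 : 0 < r := by positivity
  have hmarkov : r * μ.real {z | r ≤ ‖z‖ ^ 2} ≤ 2 :=
    (mul_meas_ge_le_integral_of_nonneg (Filter.Eventually.of_forall fun z => sq_nonneg ‖z‖)
      hint r).trans h2
  have htail : μ.real {z | r ≤ ‖z‖ ^ 2} ≤ 2 * √δ := by
    rw [hr, div_mul_eq_mul_div, one_mul, div_le_iff₀ hsδ] at hmarkov
    exact hmarkov
  have hsub : A ⊆ (A ∩ Metric.ball 0 √r) ∪ {z | r ≤ ‖z‖ ^ 2} := by
    intro z hz
    rcases lt_or_ge (‖z‖ ^ 2) r with hzr | hzr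
    · exact Or.inl ⟨hz, by rw [mem_ball_zero_iff]; exact Real.lt_sqrt_of_sq_lt hzr⟩
    · exact Or.inr hzr
  have hvol : (volume : Measure ℂ).real (A ∩ Metric.ball 0 √r) ≤ Real.pi * r := by
    calc (volume : Measure ℂ).real (A ∩ Metric.ball 0 √r)
        ≤ (volume : Measure ℂ).real (Metric.ball 0 √r) :=
          measureReal_mono Set.inter_subset_right measure_ball_lt_top.ne
      _ = Real.pi * r := by
          rw [Measure.real, Complex.volume_ball, ENNReal.toReal_mul, ENNReal.toReal_pow,
            ENNReal.toReal_ofReal (Real.sqrt_nonneg _), Real.sq_sqrt hr0.le, mul_comm]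
          simp
  have hmain : μ.real (A ∩ Metric.ball 0 √r)
      ≤ ν.real (A ∩ Metric.ball 0 √r) + δ * (volume : Measure ℂ).real (A ∩ Metric.ball 0 √r) := by
    have hfin : (volume : Measure ℂ) (A ∩ Metric.ball 0 √r) ≠ ⊤ :=
      ((measure_mono Set.inter_subset_right).trans_lt measure_ball_lt_top).ne
    have := h (A ∩ Metric.ball 0 √r)
    rw [Measure.add_apply, Measure.smul_apply, smul_eq_mul] at this
    have h' := ENNReal.toReal_mono (ENNReal.add_ne_top.2 ⟨measure_ne_top _ _,
      ENNReal.mul_ne_top ENNReal.ofReal_ne_top hfin⟩) this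
    rwa [ENNReal.toReal_add (measure_ne_top _ _) (ENNReal.mul_ne_top ENNReal.ofReal_ne_top hfin),
      ENNReal.toReal_mul, ENNReal.toReal_ofReal hδ.le] at h'
  have hδr : δ * (Real.pi * r) = Real.pi * √δ := by
    rw [hr]; field_simp; rw [Real.sq_sqrt hδ.le]
  calc μ.real A ≤ μ.real (A ∩ Metric.ball 0 √r) + μ.real {z | r ≤ ‖z‖ ^ 2} :=
        (measureReal_mono hsub).trans (measureReal_union_le _ _)
    _ ≤ (ν.real (A ∩ Metric.ball 0 √r) + δ * (Real.pi * r)) + 2 * √δ := by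
        gcongr
        exact hmain.trans (by gcongr)
    _ ≤ ν.real A + (Real.pi + 2) * √δ := by
        rw [hδr]
        have : ν.real (A ∩ Metric.ball 0 √r) ≤ ν.real A := measureReal_mono Set.inter_subset_left
        linarith

theorem inner_conj_mul_left (c z w : ℂ) :
    inner ℝ ((starRingEnd ℂ) c * z) w = inner ℝ z (c * w) := by
  rw [Complex.inner, Complex.inner, map_mul, Complex.conj_conj]
  ring_nf

theorem charFun_map_conj_mul (μ : Measure ℂ) (c ξ : ℂ) :
    charFun (μ.map fun z => (starRingEnd ℂ) c * z) ξ = charFun μ (c * ξ) := by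
  rw [charFun_apply, integral_map (by fun_prop) (Continuous.aestronglyMeasurable (by fun_prop))]
  simp only [inner_conj_mul_left, charFun_apply]

/-- Multiplication by the conjugate is the adjoint of multiplication, so rotating the law by `-α`
amounts to rotating the wedge by `α`. -/
theorem map_rotation_doubleWedge (μ : Measure ℂ) (θ α : ℝ) :
    (μ.map fun z => (starRingEnd ℂ) (Complex.exp (α * Complex.I)) * z).real (doubleWedge θ 0)
      = μ.real (doubleWedge θ α) := by
  rw [map_measureReal_apply (by fun_prop) (measurableSet_doubleWedge θ 0)]
  congr 1
  ext z
  simp only [doubleWedge, Set.mem_preimage, Set.mem_ofPred_eq, zero_add]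
  have key : ∀ u c : ℂ, inner ℝ u ((starRingEnd ℂ) c * z) = inner ℝ (c * u) z := fun u c => by
    rw [real_inner_comm, inner_conj_mul_left, real_inner_comm]
  rw [key, key, ← Complex.exp_add, ← Complex.exp_add, Complex.ofReal_add, add_mul,
    Complex.ofReal_zero, zero_mul, add_zero]

/-- A planar probability measure with second moment at most `2`, decaying characteristic function
and almost rotation-invariant characteristic function gives each double wedge almost its share. -/
theorem abs_measureReal_doubleWedge_sub_le {μ : Measure ℂ} [IsProbabilityMeasure μ]
    (h0μ : μ {0} = 0) (hint : Integrable (fun z => ‖z‖ ^ 2) μ) (h2 : ∫ z, ‖z‖ ^ 2 ∂μ ≤ 2)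
    {ε C ρ S : ℝ} {k : ℕ} (hε : 0 < ε) (hC : 0 ≤ C) (hρ : 0 < ρ) (hS : 0 < S) (hk : 3 ≤ k)
    (heq : ε * S ^ (k + 1) = C * ρ ^ k)
    (hell : ∀ w : ℂ, ‖∫ z, ((inner ℝ (Complex.I * w) z : ℝ) : ℂ)
      * Complex.exp (((inner ℝ w z : ℝ) : ℂ) * Complex.I) ∂μ‖ ≤ 2 * ε * ‖w‖)
    (hdecay : ∀ ξ : ℂ, ‖charFun μ ((2 * Real.pi) • ξ)‖ ≤ C * (1 + ‖ξ‖ / ρ) ^ (-(k : ℤ)))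
    {θ : ℝ} (h0 : 0 ≤ θ) (hπ : θ ≤ Real.pi) :
    |μ.real (doubleWedge θ 0) - θ / Real.pi| ≤
      (Real.pi + 2) * √(64 * Real.pi ^ 2 * (∫ ξ : ℂ, (1 + ‖ξ‖) ^ (-3 : ℝ)) + 1) * √(ε * S ^ 3) := by
  set J : ℝ := ∫ ξ : ℂ, (1 + ‖ξ‖) ^ (-3 : ℝ) with hJ
  have hJ0 : 0 ≤ J := integral_nonneg fun ξ => by positivity
  -- `64π²` is `8` times the `c = 8π²` used below, and `S³` is `S` times the Jacobian `S²`; the `+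
  -- 1` gives `δ > 0` without showing `J > 0`.
  set δ : ℝ := (64 * Real.pi ^ 2 * J + 1) * (ε * S ^ 3) with hδ
  have hδ0 : 0 < δ := by positivity
  set B : ℝ := (Real.pi + 2) * √δ with hB
  have hid : Integrable (fun z => z) μ := by
    have : MemLp (fun z : ℂ => z) 2 μ :=
      (memLp_two_iff_integrable_sq_norm (by fun_prop)).2 hint
    exact this.integrable (by norm_num)
  have hpi := Real.pi_gt_three
  have hrot : ∀ α : ℝ, 0 ≤ α → α ≤ 2 * Real.pi →
      |μ.real (doubleWedge θ α) - μ.real (doubleWedge θ 0)| ≤ B := by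
    intro α hα hα2
    set e : ℂ := Complex.exp (α * Complex.I) with he
    have hen : ‖e‖ = 1 := Complex.norm_exp_ofReal_mul_I α
    set ν : Measure ℂ := μ.map fun z => (starRingEnd ℂ) e * z with hν
    have : IsProbabilityMeasure ν := Measure.isProbabilityMeasure_map (by fun_prop)
    have hchar : ∀ ξ : ℂ, charFun ν ((2 * Real.pi) • ξ)
        = charFun μ (e * ((2 * Real.pi) • ξ)) := fun ξ => charFun_map_conj_mul μ e _
    have hpt : ∀ ξ : ℂ, ‖charFun μ ((2 * Real.pi) • ξ) - charFun ν ((2 * Real.pi) • ξ)‖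
        ≤ 8 * (8 * Real.pi ^ 2) * ε * S * (1 + ‖ξ‖ / S) ^ (-3 : ℝ) := by
      intro ξ
      -- Here `c = 8π²`, the product of the `2` in `hell`, the `2π` of the Fourier normalisation and
      -- `α ≤ 2π`.
      refine le_rpow_neg_three_of_le_of_le (by nlinarith) hε.le hS hC hρ (norm_nonneg ξ) hk heq
        ?_ ?_
      · rw [hchar, norm_sub_rev]
        refine (norm_charFun_rotation_sub_le μ hid hell _ hα).trans ?_
        rw [norm_smul, Real.norm_of_nonneg (by positivity)]
        calc 2 * ε * (2 * Real.pi * ‖ξ‖) * α ≤ 2 * ε * (2 * Real.pi * ‖ξ‖) * (2 * Real.pi) := by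
              gcongr
          _ = _ := by ring
      · refine (norm_sub_le _ _).trans ?_
        have h1 := hdecay ξ
        have h3 := hdecay (e * ξ)
        rw [norm_mul, hen, one_mul, ← mul_smul_comm, ← hchar] at h3
        linarith
    have hmeas : ∀ (τ : Measure ℂ) [IsFiniteMeasure τ],
        AEStronglyMeasurable fun ξ : ℂ => charFun τ ((2 * Real.pi) • ξ) := fun τ _ =>
      ((measurable_charFun (μ := τ)).comp (measurable_const_smul _)).aestronglyMeasurable
    have hdom := (integrable_one_add_norm_div_rpow hS).const_mul (8 * (8 * Real.pi ^ 2) * ε * S)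
    have hI : Integrable fun ξ : ℂ =>
        charFun μ ((2 * Real.pi) • ξ) - charFun ν ((2 * Real.pi) • ξ) :=
      hdom.mono' ((hmeas μ).sub (hmeas ν)) (Filter.Eventually.of_forall hpt)
    have hIδ : ∫ ξ : ℂ, ‖charFun μ ((2 * Real.pi) • ξ) - charFun ν ((2 * Real.pi) • ξ)‖ ≤ δ := by
      refine (integral_mono hI.norm hdom hpt).trans ?_
      rw [integral_const_mul, integral_one_add_norm_div_rpow hS, hδ, ← hJ]
      have : 0 < ε * S ^ 3 := by positivity
      nlinarith
    have hle1 := measure_le_add_smul_volume_of_integral_charFun_sub_le μ ν hI hIδ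
    have hle2 := measure_le_add_smul_volume_of_integral_charFun_sub_le ν μ
      (by simpa only [Pi.neg_def, neg_sub] using hI.neg) (by simpa only [norm_sub_rev] using hIδ)
    have hnorm : ∀ z : ℂ, ‖(starRingEnd ℂ) e * z‖ = ‖z‖ := fun z => by simp [hen]
    have hintν : Integrable (fun z => ‖z‖ ^ 2) ν := by
      rw [hν, integrable_map_measure (by fun_prop) (by fun_prop)]
      simpa [Function.comp_def, hnorm, hen] using hint
    have h2ν : ∫ z, ‖z‖ ^ 2 ∂ν ≤ 2 := by
      rw [hν, integral_map (by fun_prop) (by fun_prop)]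
      simpa [hnorm, hen] using h2
    have b1 := measureReal_le_add_sqrt hδ0 hle1 hint h2 (doubleWedge θ 0)
    have b2 := measureReal_le_add_sqrt hδ0 hle2 hintν h2ν (doubleWedge θ 0)
    rw [map_rotation_doubleWedge] at b1 b2
    rw [abs_le]
    constructor <;> linarith
  -- The average over `α` is exact, so the uniform bound `hrot` transfers to the deviation of the
  -- wedge at angle `0` from it.
  have havg := integral_measureReal_doubleWedge μ h0μ h0 hπ
  have hmeasW : Measurable fun α => μ.real (doubleWedge θ α) :=
    (measurable_measure_prodMk_left (measurableSet_doubleWedge_prod θ)).ennreal_toReal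
  have hii : IntervalIntegrable (fun α => μ.real (doubleWedge θ α)) volume 0 (2 * Real.pi) := by
    rw [intervalIntegrable_iff, Set.uIoc]
    refine (integrable_const (1 : ℝ)).mono hmeasW.aestronglyMeasurable ?_
    refine Filter.Eventually.of_forall fun α => ?_
    rw [Real.norm_of_nonneg measureReal_nonneg, norm_one]
    exact measureReal_le_one
  have hdiff : ∫ α in (0 : ℝ)..2 * Real.pi, (μ.real (doubleWedge θ α) - μ.real (doubleWedge θ 0))
      = 2 * θ - 2 * Real.pi * μ.real (doubleWedge θ 0) := by
    rw [intervalIntegral.integral_sub hii intervalIntegrable_const, havg]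
    simp
  have hbd := intervalIntegral.norm_integral_le_of_norm_le_const (a := 0) (b := 2 * Real.pi)
    (f := fun α => μ.real (doubleWedge θ α) - μ.real (doubleWedge θ 0)) (C := B) fun α hα => by
      rw [Set.uIoc_of_le (by positivity)] at hα
      exact hrot α hα.1.le hα.2
  rw [hdiff, sub_zero, abs_of_pos (by positivity), Real.norm_eq_abs] at hbd
  have hfinal : |μ.real (doubleWedge θ 0) - θ / Real.pi| ≤ B := by
    have e1 : 2 * θ - 2 * Real.pi * μ.real (doubleWedge θ 0)
        = -(2 * Real.pi) * (μ.real (doubleWedge θ 0) - θ / Real.pi) := by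
      field_simp; ring
    rw [e1, abs_mul, abs_neg, abs_of_pos (by positivity : 0 < 2 * Real.pi), mul_comm B] at hbd
    exact le_of_mul_le_mul_left hbd (by positivity)
  rw [mul_assoc, ← Real.sqrt_mul (by positivity)]
  exact hfinal

/-- Solving the balance equation gives `S = (C * √t ^ k / ε) ^ (1 / (k + 1))`. The resulting powers
`C ^ (3 / (2(k+1)))` and `t ^ (3k / (4(k+1)))` are weakened to the stated ones, using `1 ≤ C` and
splitting on `t ≤ 1`. -/
theorem exists_scale_sqrt_le {C t ε : ℝ} {k : ℕ} (hC : 1 ≤ C) (ht : 0 < t) (hε : 0 < ε) :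
    ∃ S : ℝ, 0 < S ∧ ε * S ^ (k + 1) = C * √t ^ k ∧
      √(ε * S ^ 3) ≤ C ^ ((3 : ℝ) / ((k : ℝ) + 1)) * max 1 (t ^ ((3 : ℝ) / 2))
        * ε ^ ((1 : ℝ) / 2 - 3 / (2 * ((k : ℝ) + 1))) := by
  have hC0 : 0 < C := one_pos.trans_le hC
  have hst : 0 < √t := Real.sqrt_pos.2 ht
  set n : ℝ := (k : ℝ) + 1 with hn
  have hn0 : 0 < n := by positivity
  set A : ℝ := C * √t ^ k with hA
  have hA0 : 0 < A := by positivity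
  refine ⟨(A / ε) ^ (1 / n), by positivity, ?_, ?_⟩
  · rw [← Real.rpow_natCast, ← Real.rpow_mul (by positivity)]
    push_cast
    rw [← hn, one_div_mul_cancel hn0.ne', Real.rpow_one, mul_div_cancel₀ _ hε.ne']
  · have h1 : √(ε * ((A / ε) ^ (1 / n)) ^ 3)
        = A ^ (3 / (2 * n)) * ε ^ ((1 : ℝ) / 2 - 3 / (2 * n)) := by
      rw [Real.sqrt_eq_rpow, Real.mul_rpow hε.le (by positivity), ← Real.rpow_natCast,
        ← Real.rpow_mul (by positivity), ← Real.rpow_mul (by positivity),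
        show 1 / n * (((3 : ℕ) : ℝ) * (1 / 2)) = 3 / (2 * n) by push_cast; field_simp,
        Real.div_rpow hA0.le hε.le, Real.rpow_sub hε]
      ring
    rw [h1]
    gcongr
    rw [hA, Real.mul_rpow hC0.le (by positivity)]
    gcongr ?_ * ?_
    · refine Real.rpow_le_rpow_of_exponent_le hC ?_
      gcongr
      linarith
    · have h2 : (√t ^ k) ^ (3 / (2 * n)) = t ^ (3 * (k : ℝ) / (4 * n)) := by
        rw [Real.sqrt_eq_rpow, ← Real.rpow_natCast, ← Real.rpow_mul ht.le, ← Real.rpow_mul ht.le]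
        congr 1
        field_simp
        ring
      rw [h2]
      rcases le_total t 1 with h | h
      · exact (Real.rpow_le_one ht.le h (by positivity)).trans (le_max_left _ _)
      · refine (Real.rpow_le_rpow_of_exponent_le h ?_).trans (le_max_right _ _)
        rw [div_le_div_iff₀ (by positivity) (by norm_num)]
        linarith

/-! ### Reduction to the plane -/

/-- Gram–Schmidt for the form `M`. The coefficient `q` of `ψ` along `v₂` is positive, so the angle
of `ψ` lies in `[0, π]` and is the arccosine. Positivity of `a` and `b` preserves signs of inner
products. -/
theorem exists_orthonormal_pair {d : ℕ} {M : Matrix (Fin d) (Fin d) ℝ} (hM : M.PosDef)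
    {φ ψ : EuclideanSpace ℝ (Fin d)} (hli : LinearIndependent ℝ ![φ, ψ]) :
    ∃ v₁ ∈ Submodule.span ℝ {φ, ψ}, ∃ v₂ ∈ Submodule.span ℝ {φ, ψ},
      matInner M v₁ v₁ = 1 ∧ matInner M v₂ v₂ = 1 ∧ matInner M v₁ v₂ = 0 ∧
      ∃ a b : ℝ, 0 < a ∧ 0 < b ∧ φ = a • v₁ ∧
        ψ = b • (Real.cos (Real.arccos (matCos M φ ψ)) • v₁
          + Real.sin (Real.arccos (matCos M φ ψ)) • v₂) := by
  have hφ0 : φ ≠ 0 := hli.ne_zero 0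
  have hφm : φ ∈ Submodule.span ℝ {φ, ψ} := Submodule.subset_span (by simp)
  have hψm : ψ ∈ Submodule.span ℝ {φ, ψ} := Submodule.subset_span (by simp)
  have hH := hM.isHermitian
  set a : ℝ := matNorm M φ with ha
  have ha2 : matInner M φ φ = a ^ 2 := (Real.sq_sqrt (matInner_self_pos hM hφ0).le).symm
  have ha0 : 0 < a := Real.sqrt_pos.2 (matInner_self_pos hM hφ0)
  set v₁ := a⁻¹ • φ with hv₁
  have hφ : φ = a • v₁ := by rw [hv₁, smul_inv_smul₀ ha0.ne']
  have h11 : matInner M v₁ v₁ = 1 := by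
    rw [hv₁, matInner_smul_left, matInner_smul_right, ha2]; field_simp
  set p : ℝ := matInner M v₁ ψ with hp
  set χ := ψ + (-p) • v₁ with hχ
  have hχ0 : χ ≠ 0 := by
    intro h
    have := (LinearIndependent.pair_iff.1 hli) (-(p * a⁻¹)) 1 (by
      rw [← h, hχ, hv₁, smul_smul]; module)
    exact one_ne_zero this.2
  set q : ℝ := matNorm M χ with hq
  have hq2 : matInner M χ χ = q ^ 2 := (Real.sq_sqrt (matInner_self_pos hM hχ0).le).symm
  have hq0 : 0 < q := Real.sqrt_pos.2 (matInner_self_pos hM hχ0)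
  set v₂ := q⁻¹ • χ with hv₂
  have h22 : matInner M v₂ v₂ = 1 := by
    rw [hv₂, matInner_smul_left, matInner_smul_right, hq2]; field_simp
  have h12 : matInner M v₁ v₂ = 0 := by
    rw [hv₂, matInner_smul_right, hχ, matInner_add_right, matInner_smul_right, h11, ← hp]; ring
  have h21 : matInner M v₂ v₁ = 0 := by rw [matInner_comm hH, h12]
  have hψ : ψ = p • v₁ + q • v₂ := by
    rw [hv₂, smul_inv_smul₀ hq0.ne', hχ]; module
  have hψψ : matInner M ψ ψ = p ^ 2 + q ^ 2 := by
    conv_lhs => rw [hψ]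
    simp only [matInner_add_left, matInner_add_right, matInner_smul_left, matInner_smul_right,
      h11, h22, h12, h21]
    ring
  set b : ℝ := matNorm M ψ with hb
  have hb0 : 0 < b := Real.sqrt_pos.2 (by rw [hψψ]; positivity)
  have hb2 : b ^ 2 = p ^ 2 + q ^ 2 := by
    rw [← hψψ]; exact Real.sq_sqrt (by rw [hψψ]; positivity)
  have hcosM : matCos M φ ψ = p / b := by
    rw [matCos, ← ha, ← hb]
    conv_lhs => rw [hφ, matInner_smul_left, ← hp]
    rw [mul_div_mul_left _ _ ha0.ne']
  have hpb : |p / b| ≤ 1 := by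
    rw [abs_div, abs_of_pos hb0, div_le_one hb0]
    exact abs_le_of_sq_le_sq (by nlinarith) hb0.le
  have hcos : Real.cos (Real.arccos (matCos M φ ψ)) = p / b := by
    rw [hcosM, Real.cos_arccos (abs_le.1 hpb).1 (abs_le.1 hpb).2]
  have hsin : Real.sin (Real.arccos (matCos M φ ψ)) = q / b := by
    have : 1 - (p / b) ^ 2 = (q / b) ^ 2 := by field_simp; linarith
    rw [Real.sin_arccos, hcosM, this, Real.sqrt_sq (by positivity)]
  have hv₁m : v₁ ∈ Submodule.span ℝ {φ, ψ} := Submodule.smul_mem _ _ hφm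
  refine ⟨v₁, hv₁m, v₂, Submodule.smul_mem _ _ (Submodule.add_mem _ hψm
    (Submodule.smul_mem _ _ hv₁m)), h11, h22, h12, a, b, ha0, hb0, hφ, ?_⟩
  rw [hcos, hsin, smul_add, smul_smul b, smul_smul b, mul_div_cancel₀ _ hb0.ne',
    mul_div_cancel₀ _ hb0.ne']
  exact hψ

theorem integral_exp_inner_eq_fourier_pdf {Ω : Type*} [MeasurableSpace Ω] {d : ℕ}
    (P : Measure Ω) [IsProbabilityMeasure P] (X : Ω → EuclideanSpace ℝ (Fin d))
    [HasPDF X P volume] (u : EuclideanSpace ℝ (Fin d)) :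
    ∫ ω, Complex.exp (((2 * Real.pi * inner ℝ u (X ω) : ℝ) : ℂ) * Complex.I) ∂P
      = 𝓕 (fun x : EuclideanSpace ℝ (Fin d) => (((pdf X P volume x).toReal : ℝ) : ℂ)) (-u) := by
  rw [Real.fourier_eq', ← pdf.integral_pdf_smul (μ := volume) (X := X)
    (f := fun x => Complex.exp (((2 * Real.pi * inner ℝ u x : ℝ) : ℂ) * Complex.I))
    (Continuous.aestronglyMeasurable (by fun_prop))]
  congr 1; ext x
  rw [Complex.real_smul, smul_eq_mul, mul_comm, inner_neg_right, real_inner_comm]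
  congr 4
  ring

/-- Two linear marginals of an elliptical vector, orthonormal for its covariance, give each double
wedge almost its share. -/
theorem abs_measureReal_marginal_doubleWedge_sub_le {Ω : Type*} [MeasurableSpace Ω] {d : ℕ}
    {P : Measure Ω} [IsProbabilityMeasure P] {X : Ω → EuclideanSpace ℝ (Fin d)}
    (hX : Measurable X) [HasPDF X P volume] {C ε ρ S : ℝ} {k : ℕ} (hC : 1 ≤ C) (hk : 3 ≤ k)
    (hF : ∀ ξ : EuclideanSpace ℝ (Fin d),
      ‖𝓕 (fun x : EuclideanSpace ℝ (Fin d) => (((pdf X P volume x).toReal : ℝ) : ℂ)) ξ‖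
        ≤ C * (1 + ‖ξ‖) ^ (-(k : ℤ)))
    {E : Submodule ℝ (EuclideanSpace ℝ (Fin d))} (hε : 0 < ε) (hell : IsEllipticalAlong P X ε E)
    (hρ : 0 < ρ) (hρM : ∀ u, matNorm (covMatrix P X) u ≤ ρ * ‖u‖)
    (hS : 0 < S) (heq : ε * S ^ (k + 1) = C * ρ ^ k)
    {v₁ v₂ : EuclideanSpace ℝ (Fin d)} (hv₁ : v₁ ∈ E) (hv₂ : v₂ ∈ E)
    (h11 : matInner (covMatrix P X) v₁ v₁ = 1) (h22 : matInner (covMatrix P X) v₂ v₂ = 1)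
    (h12 : matInner (covMatrix P X) v₁ v₂ = 0) {θ : ℝ} (h0 : 0 ≤ θ) (hπ : θ ≤ Real.pi) :
    |P.real {ω | SignType.sign (inner ℝ v₁ (X ω)) ≠
        SignType.sign (inner ℝ (Real.cos θ • v₁ + Real.sin θ • v₂) (X ω))} - θ / Real.pi| ≤
      (Real.pi + 2) * √(64 * Real.pi ^ 2 * (∫ ξ : ℂ, (1 + ‖ξ‖) ^ (-3 : ℝ)) + 1)
        * √(ε * S ^ 3) := by
  set M := covMatrix P X with hM
  have h21 : matInner M v₂ v₁ = 0 := by rw [matInner_comm hell.posDef.isHermitian, h12]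
  -- `T` is an isometry from `ℂ` into `E` with the `Σ`-norm, and `Y` is the adjoint image of `X`:
  -- `⟨z, Y⟩ = ⟨T z, X⟩`.
  set T : ℂ → EuclideanSpace ℝ (Fin d) := fun z => z.re • v₁ + z.im • v₂ with hT
  have hTE : ∀ z, T z ∈ E := fun z => E.add_mem (E.smul_mem _ hv₁) (E.smul_mem _ hv₂)
  have hTT : ∀ z w, matInner M (T z) (T w) = inner ℝ z w := by
    intro z w
    simp only [hT, matInner_add_left, matInner_add_right, matInner_smul_left, matInner_smul_right,
      h11, h22, h12, h21, Complex.inner, Complex.mul_re, Complex.conj_re, Complex.conj_im]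
    ring
  have hTn : ∀ z, matNorm M (T z) = ‖z‖ := fun z => by
    rw [matNorm, hTT, real_inner_self_eq_norm_sq, Real.sqrt_sq (norm_nonneg z)]
  set Y : Ω → ℂ := fun ω => ⟨inner ℝ v₁ (X ω), inner ℝ v₂ (X ω)⟩ with hY
  have hm : ∀ u : EuclideanSpace ℝ (Fin d), Measurable fun ω => (inner ℝ u (X ω) : ℝ) :=
    fun u => hX.const_inner
  have hYm : Measurable Y := by
    have : Y = fun ω => ((inner ℝ v₁ (X ω) : ℝ) : ℂ) + ((inner ℝ v₂ (X ω) : ℝ) : ℂ) * Complex.I := by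
      ext ω; exact Complex.mk_eq_add_mul_I _ _
    rw [this]
    exact (Complex.measurable_ofReal.comp (hm v₁)).add
      ((Complex.measurable_ofReal.comp (hm v₂)).mul_const _)
  have hin : ∀ z ω, inner ℝ z (Y ω) = inner ℝ (T z) (X ω) := by
    intro z ω
    simp only [hT, hY, inner_add_left, real_inner_smul_left, Complex.inner, Complex.mul_re,
      Complex.conj_re, Complex.conj_im]
    ring
  set μ : Measure ℂ := P.map Y with hμ
  have : IsProbabilityMeasure μ := Measure.isProbabilityMeasure_map hYm.aemeasurable
  have hsq : ∀ u, Integrable (fun ω => (inner ℝ u (X ω) : ℝ) ^ 2) P := fun u =>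
    (memLp_two_inner hell.memLp_two u).integrable_sq
  have hYn : ∀ ω, ‖Y ω‖ ^ 2 = (inner ℝ v₁ (X ω)) ^ 2 + (inner ℝ v₂ (X ω)) ^ 2 := fun ω => by
    rw [← Complex.normSq_eq_norm_sq, Complex.normSq_apply, sq, sq]
  have hint : Integrable (fun z => ‖z‖ ^ 2) μ := by
    rw [hμ, integrable_map_measure (by fun_prop) hYm.aemeasurable]
    simp only [Function.comp_def, hYn]
    exact (hsq v₁).add (hsq v₂)
  have h2 : ∫ z, ‖z‖ ^ 2 ∂μ ≤ 2 := by
    rw [hμ, integral_map hYm.aemeasurable (by fun_prop)]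
    simp only [hYn]
    rw [integral_add (hsq v₁) (hsq v₂), ← matInner_covMatrix_self hell.memLp_two hell.mean_zero,
      ← matInner_covMatrix_self hell.memLp_two hell.mean_zero, ← hM, h11, h22]
    norm_num
  have hv₁0 : v₁ ≠ 0 := by
    rintro rfl
    simp [matInner] at h11
  -- `Y = 0` forces `X` into the hyperplane orthogonal to `v₁`, which is Lebesgue null.
  have h0μ : μ {0} = 0 := by
    rw [hμ, Measure.map_apply hYm (measurableSet_singleton 0)]
    have hker : (volume : Measure (EuclideanSpace ℝ (Fin d)))
        (LinearMap.ker (innerₛₗ ℝ v₁) : Set (EuclideanSpace ℝ (Fin d))) = 0 := by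
      refine Measure.addHaar_submodule _ _ fun h => hv₁0 ?_
      have : v₁ ∈ LinearMap.ker (innerₛₗ ℝ v₁) := h ▸ Submodule.mem_top
      simpa using this
    have hac : P.map X ≪ volume := HasPDF.absolutelyContinuous
    refine measure_mono_null ?_ (ae_of_ae_map hX.aemeasurable
      (measure_eq_zero_iff_ae_notMem.1 (hac hker)))
    intro ω hω
    have : inner ℝ v₁ (X ω) = 0 := congrArg Complex.re hω
    simpa using this
  have hellμ : ∀ w : ℂ, ‖∫ z, ((inner ℝ (Complex.I * w) z : ℝ) : ℂ)
      * Complex.exp (((inner ℝ w z : ℝ) : ℂ) * Complex.I) ∂μ‖ ≤ 2 * ε * ‖w‖ := by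
    intro w
    rcases eq_or_ne w 0 with rfl | hw
    · simp
    rw [hμ, integral_map hYm.aemeasurable (Continuous.aestronglyMeasurable (by fun_prop))]
    simp only [hin]
    rw [mul_assoc]
    refine norm_integral_mul_exp_le_of_abs_condExp_le
      ((memLp_two_inner hell.memLp_two _).integrable (by norm_num)) (hm _) ?_
    have hTw : T w ≠ 0 := fun h => hw <| by
      rw [← norm_eq_zero, ← hTn, h]; simp [matNorm, matInner]
    -- Ellipticity with `v = T w` and `u = T (iw)`, which are `Σ`-orthogonal because `iw ⊥ w`.
    have := hell.abs_condExp_le (T w) (hTE w) hTw (T (Complex.I * w)) (by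
      rw [← hM, hTT, Complex.inner]
      simp
      ring)
    rwa [← hM, hTn, norm_mul, Complex.norm_I, one_mul] at this
  have hdecay : ∀ ξ : ℂ, ‖charFun μ ((2 * Real.pi) • ξ)‖ ≤ C * (1 + ‖ξ‖ / ρ) ^ (-(k : ℤ)) := by
    intro ξ
    have e1 : charFun μ ((2 * Real.pi) • ξ) =
        ∫ ω, Complex.exp (((2 * Real.pi * inner ℝ (T ξ) (X ω) : ℝ) : ℂ) * Complex.I) ∂P := by
      rw [charFun_apply, hμ, integral_map hYm.aemeasurable
        (Continuous.aestronglyMeasurable (by fun_prop))]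
      congr 1; ext ω
      rw [real_inner_smul_right, real_inner_comm, hin]
    rw [e1, integral_exp_inner_eq_fourier_pdf]
    refine (hF _).trans ?_
    rw [norm_neg, zpow_neg, zpow_neg, zpow_natCast, zpow_natCast]
    -- Fourier decay is in the Euclidean norm, whereas `T` preserves the `Σ`-norm; `ρ` converts
    -- between them.
    have : ‖ξ‖ / ρ ≤ ‖T ξ‖ := by
      rw [div_le_iff₀' hρ, ← hTn]
      exact hρM _
    gcongr
  have key := abs_measureReal_doubleWedge_sub_le h0μ hint h2 hε (zero_le_one.trans hC) hρ hS hk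
    heq hellμ hdecay h0 hπ
  have hset : μ.real (doubleWedge θ 0) = P.real {ω | SignType.sign (inner ℝ v₁ (X ω)) ≠
        SignType.sign (inner ℝ (Real.cos θ • v₁ + Real.sin θ • v₂) (X ω))} := by
    rw [hμ, map_measureReal_apply hYm (measurableSet_doubleWedge θ 0)]
    congr 1; ext ω
    simp only [doubleWedge, Set.mem_preimage, Set.mem_ofPred_eq, hin, zero_add]
    have e1 : T (Complex.exp (((0 : ℝ) : ℂ) * Complex.I)) = v₁ := by simp [hT]
    have e2 : T (Complex.exp ((θ : ℂ) * Complex.I)) = Real.cos θ • v₁ + Real.sin θ • v₂ := by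
      simp only [hT, Complex.exp_ofReal_mul_I_re, Complex.exp_ofReal_mul_I_im]
    rw [e1, e2]
  rwa [hset] at key

/-! ### Conclusion -/

theorem IsEllipticalAlong.mono {Ω : Type*} [MeasurableSpace Ω] {d : ℕ} {P : Measure Ω}
    {X : Ω → EuclideanSpace ℝ (Fin d)} {ε ε' : ℝ} {E : Submodule ℝ (EuclideanSpace ℝ (Fin d))}
    (h : IsEllipticalAlong P X ε E) (hε : ε ≤ ε') : IsEllipticalAlong P X ε' E where
  memLp_two := h.memLp_two
  mean_zero := h.mean_zero
  posDef := h.posDef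
  ne_bot := h.ne_bot
  abs_condExp_le v hv hv0 u hu := by
    filter_upwards [h.abs_condExp_le v hv hv0 u hu] with ω hω
    exact hω.trans (mul_le_mul_of_nonneg_right hε (Real.sqrt_nonneg _))

theorem mainTheorem3 :
    ∃ K : ℝ, 0 < K ∧
      ∀ (d : ℕ), 2 ≤ d →
      ∀ (Ω : Type*) [MeasurableSpace Ω] (P : Measure Ω) [IsProbabilityMeasure P]
        (X : Ω → EuclideanSpace ℝ (Fin d)), Measurable X → HasPDF X P volume →
      ∀ (C : ℝ) (k : ℕ), 1 ≤ C → 3 ≤ k →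
        (∀ ξ : EuclideanSpace ℝ (Fin d),
          ‖𝓕 (fun x : EuclideanSpace ℝ (Fin d) => (((pdf X P volume x).toReal : ℝ) : ℂ)) ξ‖
            ≤ C * (1 + ‖ξ‖) ^ (-(k : ℤ))) →
      ∀ (φ ψ : EuclideanSpace ℝ (Fin d)), LinearIndependent ℝ ![φ, ψ] →
      ∀ (ε : ℝ), 0 ≤ ε → IsEllipticalAlong P X ε (Submodule.span ℝ {φ, ψ}) →
        |P.real {ω | SignType.sign (inner ℝ φ (X ω)) ≠ SignType.sign (inner ℝ ψ (X ω))}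
            - 1 / Real.pi * Real.arccos (matCos (covMatrix P X) φ ψ)|
          ≤ K * C ^ ((3 : ℝ) / ((k : ℝ) + 1))
              * max 1 (topEigenvalue (covMatrix P X) ^ ((3 : ℝ) / 2))
              * ε ^ ((1 : ℝ) / 2 - 3 / (2 * ((k : ℝ) + 1))) := by
  have hJ : 0 ≤ ∫ ξ : ℂ, (1 + ‖ξ‖) ^ (-3 : ℝ) := integral_nonneg fun ξ => by positivity
  set K : ℝ := (Real.pi + 2) * √(64 * Real.pi ^ 2 * (∫ ξ : ℂ, (1 + ‖ξ‖) ^ (-3 : ℝ)) + 1) with hK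
  refine ⟨K, by positivity, ?_⟩
  intro d hd Ω _ P _ X hX hpdf C k hC hk hF φ ψ hli ε hε hell
  set M := covMatrix P X with hM
  have hMpos : M.PosDef := hell.posDef
  have htop : 0 < topEigenvalue M := topEigenvalue_pos (by omega) hMpos
  obtain ⟨v₁, hv₁, v₂, hv₂, h11, h22, h12, a, b, ha, hb, hφ, hψ⟩ :=
    exists_orthonormal_pair hMpos hli
  set θ : ℝ := Real.arccos (matCos M φ ψ) with hθ
  have hset : {ω | SignType.sign (inner ℝ φ (X ω)) ≠ SignType.sign (inner ℝ ψ (X ω))}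
      = {ω | SignType.sign (inner ℝ v₁ (X ω)) ≠
        SignType.sign (inner ℝ (Real.cos θ • v₁ + Real.sin θ • v₂) (X ω))} := by
    ext ω
    have e1 : SignType.sign (inner ℝ φ (X ω)) = SignType.sign (inner ℝ v₁ (X ω)) := by
      rw [hφ, real_inner_smul_left, sign_mul, sign_pos ha, one_mul]
    have e2 : SignType.sign (inner ℝ ψ (X ω)) =
        SignType.sign (inner ℝ (Real.cos θ • v₁ + Real.sin θ • v₂) (X ω)) := by
      rw [hψ, real_inner_smul_left, sign_mul, sign_pos hb, one_mul]
    rw [Set.mem_ofPred_eq, Set.mem_ofPred_eq, e1, e2]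
  have hρM : ∀ u, matNorm M u ≤ √(topEigenvalue M) * ‖u‖ := by
    intro u
    rw [matNorm, ← Real.sqrt_sq (norm_nonneg u), ← Real.sqrt_mul htop.le]
    exact Real.sqrt_le_sqrt (matInner_self_le_topEigenvalue_mul hMpos.isHermitian u)
  rw [hset, one_div_mul_eq_div]
  -- The scale `S` requires a positive parameter and `ε` may be `0`, so the bound is proved for
  -- every `ε' > ε`; letting `ε'` decrease to `ε` uses continuity of the power, whose exponent is
  -- nonnegative.
  have hpos : ∀ ε' > ε, |P.real {ω | SignType.sign (inner ℝ v₁ (X ω)) ≠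
        SignType.sign (inner ℝ (Real.cos θ • v₁ + Real.sin θ • v₂) (X ω))} - θ / Real.pi| ≤ K * C ^ ((3 : ℝ) / ((k : ℝ) + 1))
      * max 1 (topEigenvalue M ^ ((3 : ℝ) / 2))
      * ε' ^ ((1 : ℝ) / 2 - 3 / (2 * ((k : ℝ) + 1))) := by
    intro ε' hε'
    have hε'0 : 0 < ε' := hε.trans_lt hε'
    obtain ⟨S, hS, heq, hle⟩ := exists_scale_sqrt_le (k := k) hC htop hε'0
    refine (abs_measureReal_marginal_doubleWedge_sub_le hX hC hk hF hε'0 (hell.mono hε'.le)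
      (Real.sqrt_pos.2 htop) hρM hS heq hv₁ hv₂ h11 h22 h12 (Real.arccos_nonneg _)
      (Real.arccos_le_pi _)).trans ?_
    exact (mul_le_mul_of_nonneg_left hle (by positivity : 0 ≤ K)).trans_eq (by ring)
  have hexp : 0 ≤ (1 : ℝ) / 2 - 3 / (2 * ((k : ℝ) + 1)) := by
    have : (3 : ℝ) ≤ k := by exact_mod_cast hk
    rw [sub_nonneg, div_le_div_iff₀ (by positivity) (by norm_num)]
    linarith
  have hcont : Continuous fun t : ℝ => K * C ^ ((3 : ℝ) / ((k : ℝ) + 1))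
      * max 1 (topEigenvalue M ^ ((3 : ℝ) / 2))
      * t ^ ((1 : ℝ) / 2 - 3 / (2 * ((k : ℝ) + 1))) :=
    continuous_const.mul (Real.continuous_rpow_const hexp)
  exact ge_of_tendsto (hcont.continuousWithinAt (s := Set.Ioi ε))
    (eventually_mem_nhdsWithin.mono fun t ht => hpos t ht)
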